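/- Let $p$ be an odd prime and let $E/\mathbb{Q}$ be an elliptic curve. For a prime $\ell$ let $c_\ell=[E(\mathbb{Q}_\ell):E_0(\mathbb{Q}_\ell)]$ be the Tamagawa number of $E$ at $\ell$, where $E_0(\mathbb{Q}_\ell)$ is the subgroup of points with nonsingular reduction on a minimal Weierstrass model over $\mathbb{Z}_\ell$. Let $\bar T=E[p]$ be the $p$-torsion of $E(\bar{\mathbb{Q}})$, regarded as an $\mathbb{F}_p$-representation of $\mathrm{Gal}(\bar{\mathbb{Q}}/\mathbb{Q})$, and let $H^0(\mathbb{Q}_\ell,\bar T)$ be the subspace fixed by a decomposition group at $\ell$, i.e. by the image of $\mathrm{Gal}(\bar{\mathbb{Q}}_\ell/\mathbb{Q}_\ell)$ under restriction along an embedding $\bar{\mathbb{Q}}\hookrightarrow\bar{\mathbb{Q}}_\ell$ (any such embedding may be chosen). 1. If $\ell$ is a prime (possibly $\ell=p$) at which $E$ has split multiplicative reduction, and if $p\nmid c_\ell$ and $p\nmid \ell-1$, then $H^0(\mathbb{Q}_\ell,\bar T)=0$. 2. Consequently, if at every prime $\ell$ of bad reduction of $E$ (equivalently, every prime $\ell$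 dividing the conductor $N_E$) the curve has split multiplicative reduction and $p\nmid c_\ell$, $p\nmid \ell-1$, then the hypothesis (H.Tam) holds for $\bar T=E[p]$: $H^0(\mathbb{Q}_\ell,\bar T)=0$ for all primes $\ell$ of bad reduction. -/

import Mathlib

noncomputable section

namespace TamagawaCondition

open Classical in
/-- The action of `Gal(K̄/K)` on the group `E(K̄)`, coordinatewise on affine points. -/
def galoisActionOnPoints {K : Type*} [Field K] (E : WeierstrassCurve K) :
    Gal(AlgebraicClosure K/K) →*
      AddMonoid.End (E.baseChange (AlgebraicClosure K)).toAffine.Point where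
  toFun σ := WeierstrassCurve.Affine.Point.map (W' := E.toAffine) (σ : _ →ₐ[K] _)
  map_one' := by
    ext P
    cases P <;> rfl
  map_mul' σ τ := by
    ext P
    cases P <;> rfl

open Classical in
/-- The underlying group of `E[n]`: the `n`-torsion subgroup of `E(K̄)`. -/
abbrev torsionPoints {K : Type*} [Field K] (E : WeierstrassCurve K) (n : ℕ) :
    AddSubgroup (E.baseChange (AlgebraicClosure K)).toAffine.Point :=
  AddSubgroup.torsionBy (E.baseChange (AlgebraicClosure K)).toAffine.Point (n : ℤ)

open Classical in
instance torsionPointsModule {K : Type*} [Field K] (E : WeierstrassCurve K) (n : ℕ) :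
    Module (ZMod n) (torsionPoints E n) :=
  AddSubgroup.torsionBy.zmodModule

open Classical in
theorem galoisActionOnPoints_mem_torsionPoints {K : Type*} [Field K] (E : WeierstrassCurve K)
    (n : ℕ) (σ : Gal(AlgebraicClosure K/K)) (P : torsionPoints E n) :
    galoisActionOnPoints E σ P ∈ torsionPoints E n := by
  have hP : n • (P : (E.baseChange (AlgebraicClosure K)).toAffine.Point) = 0 :=
    AddSubgroup.torsionBy.nsmul_iff.mp P.2
  refine AddSubgroup.torsionBy.nsmul_iff.mpr ?_
  rw [← map_nsmul, hP, map_zero]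

open Classical in
/-- The mod `n` Galois representation `E[n]` of `Gal(K̄/K)`. -/
def torsionRepresentation {K : Type*} [Field K] (E : WeierstrassCurve K) (n : ℕ) :
    Representation (ZMod n) Gal(AlgebraicClosure K/K) (torsionPoints E n) where
  toFun σ := AddMonoidHom.toZModLinearMap n
    { toFun := fun P => ⟨galoisActionOnPoints E σ P, galoisActionOnPoints_mem_torsionPoints E n σ P⟩
      map_zero' := Subtype.ext (map_zero (galoisActionOnPoints E σ))
      map_add' := fun P Q => Subtype.ext (map_add (galoisActionOnPoints E σ) P.1 Q.1) }
  map_one' := by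
    ext P
    simp
  map_mul' σ τ := by
    ext P
    simp

/-- For an extension `L/K` and a `K`-embedding `ι : K̄ → L̄`, the restriction homomorphism
`Gal(L̄/L) → Gal(K̄/K)`. For `K = ℚ` and `L = ℚ_ℓ` it identifies `Gal(L̄/L)` with
the decomposition group of the place of `K̄` above `ℓ` that `ι` determines. -/
def restrictGalois {K L : Type*} [Field K] [Field L] [Algebra K L]
    (ι : AlgebraicClosure K →ₐ[K] AlgebraicClosure L) :
    Gal(AlgebraicClosure L/L) →* Gal(AlgebraicClosure K/K) :=
  letI : Algebra (AlgebraicClosure K) (AlgebraicClosure L) := ι.toRingHom.toAlgebra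
  haveI : IsScalarTower K (AlgebraicClosure K) (AlgebraicClosure L) :=
    IsScalarTower.of_algebraMap_eq fun x => (ι.commutes x).symm
  (AlgEquiv.restrictNormalHom (AlgebraicClosure K)).comp
    (AlgEquiv.restrictScalarsHom K :
      Gal(AlgebraicClosure L/L) →* (AlgebraicClosure L ≃ₐ[K] AlgebraicClosure L))

theorem restrictGalois_spec {K L : Type*} [Field K] [Field L] [Algebra K L]
    (ι : AlgebraicClosure K →ₐ[K] AlgebraicClosure L) (σ : Gal(AlgebraicClosure L/L))
    (x : AlgebraicClosure K) : ι (restrictGalois ι σ x) = σ (ι x) := by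
  let _ : Algebra (AlgebraicClosure K) (AlgebraicClosure L) := ι.toRingHom.toAlgebra
  have _ : IsScalarTower K (AlgebraicClosure K) (AlgebraicClosure L) :=
    IsScalarTower.of_algebraMap_eq fun x => (ι.commutes x).symm
  exact AlgEquiv.restrictNormal_commutes (σ.restrictScalars K) (AlgebraicClosure K) x

/-- `H⁰(L, V)` for a representation `V` of `Gal(K̄/K)`: the vectors fixed by `Gal(L̄/L)`, which
acts through the restriction homomorphism given by `ι`. -/
def localH0 {K L : Type*} [Field K] [Field L] [Algebra K L]
    (ι : AlgebraicClosure K →ₐ[K] AlgebraicClosure L)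
    {k V : Type*} [CommRing k] [AddCommGroup V] [Module k V]
    (ρ : Representation k Gal(AlgebraicClosure K/K) V) : Submodule k V :=
  Representation.invariants (ρ.comp (restrictGalois ι))

section Local

variable (R : Type*) [CommRing R] [IsDomain R] [IsDiscreteValuationRing R]
variable {K : Type*} [Field K] [Algebra R K] [IsFractionRing R K]

/-- The reduction of a point of a minimal Weierstrass equation `W` is a nonsingular point of the
reduced curve. The point `O` reduces to the nonsingular point `O`, and so does an affine point whose
coordinates are not in `R` (if one coordinate is in `R`, so is the other, since both satisfy the
Weierstrass equation, which is monic in each). -/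
def HasNonsingularReduction (W : WeierstrassCurve K) [W.IsMinimal R] : W.toAffine.Point → Prop
  | .zero => True
  | .some x y _ => ∀ x₀ y₀ : R, algebraMap R K x₀ = x → algebraMap R K y₀ = y →
      (W.reduction R).toAffine.Nonsingular
        (IsLocalRing.residue R x₀) (IsLocalRing.residue R y₀)

open Classical in
/-- The subgroup `E₀(K)` of points with nonsingular reduction. These points already form a
subgroup, so that taking the generated subgroup adds nothing. -/
def nonsingularReductionSubgroup (W : WeierstrassCurve K) [W.IsMinimal R] :
    AddSubgroup W.toAffine.Point :=
  AddSubgroup.closure {P | HasNonsingularReduction R W P}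

open Classical in
/-- The Tamagawa number `[E(K) : E₀(K)]`, computed on a minimal Weierstrass equation. -/
def tamagawaNumber (W : WeierstrassCurve K) : ℕ :=
  (nonsingularReductionSubgroup R (W.minimal R)).index

end Local

/-- `E` has bad reduction at `ℓ`, that is, `ℓ` divides the conductor of `E`. -/
def IsBadPrime (E : WeierstrassCurve ℚ) (ℓ : ℕ) [Fact ℓ.Prime] : Prop :=
  ¬ ((E.baseChange ℚ_[ℓ]).minimal ℤ_[ℓ]).HasGoodReduction ℤ_[ℓ]

/-- `E` has split multiplicative reduction at `ℓ`. -/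
def IsSplitMultiplicativePrime (E : WeierstrassCurve ℚ) (ℓ : ℕ) [Fact ℓ.Prime] : Prop :=
  ((E.baseChange ℚ_[ℓ]).minimal ℤ_[ℓ]).HasSplitMultiplicativeReduction ℤ_[ℓ]

/-- The Tamagawa number `c_ℓ` of `E` at `ℓ`. -/
def tamagawaNumberAt (E : WeierstrassCurve ℚ) (ℓ : ℕ) [Fact ℓ.Prime] : ℕ :=
  tamagawaNumber ℤ_[ℓ] (E.baseChange ℚ_[ℓ])

/-- `H⁰(ℚ_ℓ, E[p]) = 0`, for every choice of a decomposition group at `ℓ`. -/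
def LocalInvariantsVanish (E : WeierstrassCurve ℚ) (ℓ : ℕ) [Fact ℓ.Prime] (p : ℕ) : Prop :=
  ∀ ι : AlgebraicClosure ℚ →ₐ[ℚ] AlgebraicClosure ℚ_[ℓ],
    localH0 ι (torsionRepresentation E p) = ⊥

/-- The hypothesis (H.Tam) for `E[p]`: `H⁰(ℚ_ℓ, E[p]) = 0` for all bad primes `ℓ`. -/
def HTam (E : WeierstrassCurve ℚ) (p : ℕ) : Prop :=
  ∀ (ℓ : ℕ) [Fact ℓ.Prime], IsBadPrime E ℓ → LocalInvariantsVanish E ℓ p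

end TamagawaCondition

end

/-! A point of `E[p]` fixed by a decomposition group at `ℓ` has coordinates in `ℚ_ℓ`, so it suffices
that `E(ℚ_ℓ)` has no `p`-torsion. As `p ∤ c_ℓ`, such torsion lies in `E₀(ℚ_ℓ)`. Split multiplicative
reduction allows integral coordinates in which the curve reduces to `y² + a₁xy = x³`. The points of
`E₀` are then among those with integral `s = x / y` and `w = 1 / y`, and `1 + a₁s` reduces to the
isomorphism of the nonsingular locus with the multiplicative group. In place of Tate curves or
formal groups, the argument uses one estimate (`exists_add`): if the `s`-coordinates of two points
lie in an ideal `I`, then `1 + a₁s` is multiplicative on them modulo `𝔪 I²`. Suppose `pP = 0`. With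
`I = ⊤`, the reduction of `1 + a₁s` is a `p`-th root of unity, hence `1` because `p ∤ ℓ - 1`, so `s
∈ 𝔪`. With `I = (a₁s)` and `X = a₁s`, `(1 + X)^p - 1 ∈ 𝔪 X²`. For odd `p` and `X ≠ 0` this forces `p
∈ 𝔪²`, which is false in `ℤ_ℓ` even when `ℓ = p`. Hence `s = 0` and `P = 0`
(`IsSplitNodal.eq_zero_of_nsmul_eq_zero`). -/

noncomputable section

/-! ### Admissible changes of variables as homomorphisms on points. -/

namespace WeierstrassCurve.Affine

variable {K : Type*} [Field K]

theorem variableChange_equation (W : WeierstrassCurve K) (C : VariableChange K) (x y : K) :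
    (C • W).toAffine.Equation ((C.u⁻¹ : Kˣ) ^ 2 * (x - C.r))
      ((C.u⁻¹ : Kˣ) ^ 3 * (y - C.s * (x - C.r) - C.t)) ↔ W.toAffine.Equation x y := by
  have hu : ((C.u⁻¹ : Kˣ) : K) ≠ 0 := C.u⁻¹.ne_zero
  generalize hv : ((C.u⁻¹ : Kˣ) : K) = v at hu
  rw [equation_iff', equation_iff']
  simp only [variableChange_a₁, variableChange_a₂, variableChange_a₃, variableChange_a₄,
    variableChange_a₆, hv]
  refine ⟨fun h => (mul_right_inj' (pow_ne_zero 6 hu)).mp ?_, fun h => ?_⟩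
  · linear_combination h
  · linear_combination v ^ 6 * h

theorem variableChange_nonsingular (W : WeierstrassCurve K) (C : VariableChange K) (x y : K) :
    (C • W).toAffine.Nonsingular ((C.u⁻¹ : Kˣ) ^ 2 * (x - C.r))
      ((C.u⁻¹ : Kˣ) ^ 3 * (y - C.s * (x - C.r) - C.t)) ↔ W.toAffine.Nonsingular x y := by
  rw [nonsingular_iff', nonsingular_iff', variableChange_equation]
  refine and_congr_right fun _ => ?_
  have hu : ((C.u⁻¹ : Kˣ) : K) ≠ 0 := C.u⁻¹.ne_zero
  generalize hv : ((C.u⁻¹ : Kˣ) : K) = v at hu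
  simp only [variableChange_a₁, variableChange_a₂, variableChange_a₃, variableChange_a₄, hv]
  rw [← not_iff_not]
  simp only [not_or, ne_eq, not_not]
  constructor
  · rintro ⟨h1, h2⟩
    have h2' : 2 * y + W.a₁ * x + W.a₃ = 0 := by
      refine (mul_right_inj' (pow_ne_zero 3 hu)).mp ?_
      linear_combination h2
    refine ⟨(mul_right_inj' (pow_ne_zero 4 hu)).mp ?_, h2'⟩
    linear_combination h1 - v ^ 4 * C.s * h2'
  · rintro ⟨h1, h2⟩
    exact ⟨by linear_combination v ^ 4 * h1 + v ^ 4 * C.s * h2, by linear_combination v ^ 3 * h2⟩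

open Classical in
-- The substitution is affine linear and carries lines to lines, changing a slope `λ` into `u⁻¹(λ -
-- s)`; additivity on points follows from this.
theorem variableChange_slope (W : WeierstrassCurve K) (C : VariableChange K) {x₁ x₂ y₁ y₂ : K}
    (hxy : ¬(x₁ = x₂ ∧ y₁ = W.toAffine.negY x₂ y₂)) (h₁ : W.toAffine.Equation x₁ y₁)
    (h₂ : W.toAffine.Equation x₂ y₂) :
    (C • W).toAffine.slope ((C.u⁻¹ : Kˣ) ^ 2 * (x₁ - C.r)) ((C.u⁻¹ : Kˣ) ^ 2 * (x₂ - C.r))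
      ((C.u⁻¹ : Kˣ) ^ 3 * (y₁ - C.s * (x₁ - C.r) - C.t))
      ((C.u⁻¹ : Kˣ) ^ 3 * (y₂ - C.s * (x₂ - C.r) - C.t)) =
    (C.u⁻¹ : Kˣ) * (W.toAffine.slope x₁ x₂ y₁ y₂ - C.s) := by
  have hu : ((C.u⁻¹ : Kˣ) : K) ≠ 0 := C.u⁻¹.ne_zero
  generalize hv : ((C.u⁻¹ : Kˣ) : K) = v at hu
  by_cases hx : x₁ = x₂
  · have hy : y₁ ≠ W.toAffine.negY x₂ y₂ := fun h => hxy ⟨hx, h⟩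
    obtain rfl := hx
    obtain rfl := Y_eq_of_Y_ne h₁ h₂ rfl hy
    have hd : 2 * y₁ + W.a₁ * x₁ + W.a₃ ≠ 0 := fun h => hy (by rw [negY]; linear_combination h)
    have hn : v ^ 3 * (y₁ - C.s * (x₁ - C.r) - C.t) - (C • W).toAffine.negY (v ^ 2 * (x₁ - C.r))
        (v ^ 3 * (y₁ - C.s * (x₁ - C.r) - C.t)) = v ^ 3 * (2 * y₁ + W.a₁ * x₁ + W.a₃) := by
      simp only [negY, variableChange_a₁, variableChange_a₃, hv]
      ring
    have hn0 := mul_ne_zero (pow_ne_zero 3 hu) hd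
    have hm : y₁ - W.toAffine.negY x₁ y₁ = 2 * y₁ + W.a₁ * x₁ + W.a₃ := by
      simp only [negY]
      ring
    rw [slope_of_Y_ne rfl (fun h => hn0 (by rw [← hn, ← h, sub_self])), slope_of_Y_ne rfl hy,
      hn, hm]
    simp only [variableChange_a₁, variableChange_a₂, variableChange_a₄, hv]
    rw [div_eq_iff hn0]
    linear_combination -v ^ 4 * div_mul_cancel₀
      (3 * x₁ ^ 2 + 2 * W.a₂ * x₁ + W.a₄ - W.a₁ * y₁) hd
  · have hx' : v ^ 2 * (x₁ - C.r) ≠ v ^ 2 * (x₂ - C.r) := fun h => hx (by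
      simpa using mul_left_cancel₀ (pow_ne_zero 2 hu) h)
    rw [slope_of_X_ne hx', slope_of_X_ne hx]
    have := sub_ne_zero.mpr hx
    have h3 : v ^ 2 * (x₁ - C.r) - v ^ 2 * (x₂ - C.r) = v ^ 2 * (x₁ - x₂) := by ring
    rw [h3]
    field_simp
    ring

open Classical in
/-- The homomorphism on points induced by an admissible change of variables. -/
def Point.variableChange (W : WeierstrassCurve K) (C : VariableChange K) :
    W.toAffine.Point →+ (C • W).toAffine.Point where
  toFun P := match P with
    | .zero => .zero
    | .some x y h => .some _ _ ((variableChange_nonsingular W C x y).mpr h)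
  map_zero' := rfl
  map_add' := by
    rintro (_ | ⟨x₁, y₁, h₁⟩) (_ | ⟨x₂, y₂, h₂⟩)
    any_goals rfl
    have hu : ((C.u⁻¹ : Kˣ) : K) ≠ 0 := C.u⁻¹.ne_zero
    have hneg : ∀ x y, (C • W).toAffine.negY ((C.u⁻¹ : Kˣ) ^ 2 * (x - C.r))
        ((C.u⁻¹ : Kˣ) ^ 3 * (y - C.s * (x - C.r) - C.t)) =
        (C.u⁻¹ : Kˣ) ^ 3 * (W.toAffine.negY x y - C.s * (x - C.r) - C.t) := by
      intro x y
      simp only [negY, variableChange_a₁, variableChange_a₃]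
      ring
    by_cases hxy : x₁ = x₂ ∧ y₁ = W.toAffine.negY x₂ y₂
    · rw [add_of_Y_eq hxy.1 hxy.2, add_of_Y_eq (by rw [hxy.1]) (by rw [hneg, ← hxy.2, hxy.1])]
      rfl
    · have hxy' : ¬((C.u⁻¹ : Kˣ) ^ 2 * (x₁ - C.r) = (C.u⁻¹ : Kˣ) ^ 2 * (x₂ - C.r) ∧
          (C.u⁻¹ : Kˣ) ^ 3 * (y₁ - C.s * (x₁ - C.r) - C.t) =
          (C • W).toAffine.negY ((C.u⁻¹ : Kˣ) ^ 2 * (x₂ - C.r))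
            ((C.u⁻¹ : Kˣ) ^ 3 * (y₂ - C.s * (x₂ - C.r) - C.t))) := by
        rintro ⟨hx, hy⟩
        have hx : x₁ = x₂ := by simpa using mul_left_cancel₀ (pow_ne_zero 2 hu) hx
        rw [hneg] at hy
        have hy := mul_left_cancel₀ (pow_ne_zero 3 hu) hy
        rw [hx] at hy
        exact hxy ⟨hx, by linear_combination hy⟩
      rw [add_some hxy, add_some hxy']
      simp only [Point.some.injEq]
      rw [variableChange_slope W C hxy h₁.1 h₂.1]
      generalize W.toAffine.slope x₁ x₂ y₁ y₂ = ℓ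
      simp only [addX, addY, negAddY, negY, variableChange_a₁, variableChange_a₂,
        variableChange_a₃]
      constructor <;> ring

open Classical in
theorem Point.variableChange_injective (W : WeierstrassCurve K) (C : VariableChange K) :
    Function.Injective (Point.variableChange W C) := by
  rw [injective_iff_map_eq_zero]
  rintro (_ | ⟨x, y, h⟩) hP
  · rfl
  · exact absurd hP (some_ne_zero _)

end WeierstrassCurve.Affine

/-! ### The chart at infinity of a split nodal equation, and its chords. -/

namespace WeierstrassCurve

open IsLocalRing

variable {R : Type*} [CommRing R]

/-- The equation of a Weierstrass curve with `a₃ = 0` in the coordinates `s = x / y`, `w = 1 / y`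
around the point at infinity. -/
def InftyEquation (V : WeierstrassCurve R) (s w : R) : Prop :=
  w + V.a₁ * s * w = s ^ 3 + V.a₂ * s ^ 2 * w + V.a₄ * s * w ^ 2 + V.a₆ * w ^ 3

variable [IsLocalRing R]

/-- A Weierstrass equation over a local ring whose reduction is `y² + a₁xy = x³` with `a₁ ≠ 0`:
its node is the origin, with rational tangent lines, one of which is `y = 0`. -/
structure IsSplitNodal (V : WeierstrassCurve R) : Prop where
  isUnit_a₁ : IsUnit V.a₁
  a₂_mem : V.a₂ ∈ maximalIdeal R
  a₃_eq : V.a₃ = 0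
  a₄_mem : V.a₄ ∈ maximalIdeal R
  a₆_mem : V.a₆ ∈ maximalIdeal R

theorem isUnit_add_mem {u m : R} (hu : IsUnit u) (hm : m ∈ maximalIdeal R) : IsUnit (u + m) := by
  by_contra h
  exact (mem_maximalIdeal u).mp (by simpa using sub_mem ((mem_maximalIdeal _).mpr h) hm) hu

namespace IsSplitNodal

variable {V : WeierstrassCurve R} (hV : V.IsSplitNodal)
include hV

/-- Modulo `𝔪` the equation reads `w(1 + a₁s) = s³`, so if `1 + a₁s` vanished then `s` would too,
giving `1 = 0`. -/
theorem isUnit_of_inftyEquation {s w : R} (h : V.InftyEquation s w) : IsUnit (1 + V.a₁ * s) := by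
  by_contra hn
  have hn : 1 + V.a₁ * s ∈ maximalIdeal R := hn
  have hs3 : s ^ 3 ∈ maximalIdeal R := by
    have : s ^ 3 = w * (1 + V.a₁ * s) - (s ^ 2 * w * V.a₂ + s * w ^ 2 * V.a₄ + w ^ 3 * V.a₆) := by
      unfold InftyEquation at h
      linear_combination -h
    rw [this]
    exact sub_mem (Ideal.mul_mem_left _ _ hn) (add_mem (add_mem (Ideal.mul_mem_left _ _ hV.a₂_mem)
      (Ideal.mul_mem_left _ _ hV.a₄_mem)) (Ideal.mul_mem_left _ _ hV.a₆_mem))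
  have hs : s ∈ maximalIdeal R := Ideal.IsPrime.mem_of_pow_mem inferInstance _ hs3
  have h1 : (1 : R) ∈ maximalIdeal R := by
    have : (1 : R) = (1 + V.a₁ * s) - V.a₁ * s := by ring
    rw [this]
    exact sub_mem hn (Ideal.mul_mem_left _ _ hs)
  exact (Ideal.ne_top_iff_one _).mp (maximalIdeal.isMaximal R).ne_top h1

/-- Collecting the multiples of `w` turns the equation into `w · unit = s³`. -/
theorem mem_pow_three_of_inftyEquation {s w : R} (h : V.InftyEquation s w) {I : Ideal R}
    (hs : s ∈ I) : w ∈ I ^ 3 := by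
  have hu : IsUnit ((1 + V.a₁ * s) + (s ^ 2 * -V.a₂ + s * w * -V.a₄ + w ^ 2 * -V.a₆)) := by
    refine isUnit_add_mem (hV.isUnit_of_inftyEquation h) ?_
    exact (add_mem (add_mem (Ideal.mul_mem_left _ _ (neg_mem hV.a₂_mem))
      (Ideal.mul_mem_left _ _ (neg_mem hV.a₄_mem))) (Ideal.mul_mem_left _ _ (neg_mem hV.a₆_mem)))
  rw [← Ideal.mul_unit_mem_iff_mem _ hu]
  have : w * ((1 + V.a₁ * s) + (s ^ 2 * -V.a₂ + s * w * -V.a₄ + w ^ 2 * -V.a₆)) = s ^ 3 := by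
    unfold InftyEquation at h
    linear_combination h
  rw [this]
  exact Ideal.pow_mem_pow hs 3

/-- The chord (or tangent) through two points of the chart is the graph of an integral linear
function. -/
theorem exists_chord {s₁ w₁ s₂ w₂ : R} (h₁ : V.InftyEquation s₁ w₁) (h₂ : V.InftyEquation s₂ w₂)
    {I : Ideal R} (hs₁ : s₁ ∈ I) (hs₂ : s₂ ∈ I) :
    ∃ lam ν : R, lam ∈ I ^ 2 ∧ ν ∈ I ^ 2 ∧ w₁ = lam * s₁ + ν ∧ w₂ = lam * s₂ + ν ∧
      IsUnit (1 + V.a₁ * s₁ - V.a₂ * s₁ ^ 2 - V.a₄ * s₁ * (w₁ + w₂) -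
        V.a₆ * (w₁ ^ 2 + w₁ * w₂ + w₂ ^ 2)) ∧
      (1 + V.a₁ * s₁ - V.a₂ * s₁ ^ 2 - V.a₄ * s₁ * (w₁ + w₂) -
        V.a₆ * (w₁ ^ 2 + w₁ * w₂ + w₂ ^ 2)) * lam = s₁ ^ 2 + s₁ * s₂ + s₂ ^ 2 +
          V.a₂ * w₂ * (s₁ + s₂) + V.a₄ * w₂ ^ 2 - V.a₁ * w₂ := by
  have hw₁ : w₁ ∈ I ^ 2 := Ideal.pow_le_pow_right (by simp) (hV.mem_pow_three_of_inftyEquation h₁ hs₁)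
  have hw₂ : w₂ ∈ I ^ 2 := Ideal.pow_le_pow_right (by simp) (hV.mem_pow_three_of_inftyEquation h₂ hs₂)
  have hu : IsUnit (1 + V.a₁ * s₁ - V.a₂ * s₁ ^ 2 - V.a₄ * s₁ * (w₁ + w₂) -
        V.a₆ * (w₁ ^ 2 + w₁ * w₂ + w₂ ^ 2)) := by
    have : (1 + V.a₁ * s₁ - V.a₂ * s₁ ^ 2 - V.a₄ * s₁ * (w₁ + w₂) -
        V.a₆ * (w₁ ^ 2 + w₁ * w₂ + w₂ ^ 2)) = (1 + V.a₁ * s₁) + (-s₁ ^ 2 * V.a₂ +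
        -(s₁ * (w₁ + w₂)) * V.a₄ + -(w₁ ^ 2 + w₁ * w₂ + w₂ ^ 2) * V.a₆) := by ring
    rw [this]
    exact isUnit_add_mem (hV.isUnit_of_inftyEquation h₁)
      (add_mem (add_mem (Ideal.mul_mem_left _ _ hV.a₂_mem)
      (Ideal.mul_mem_left _ _ hV.a₄_mem)) (Ideal.mul_mem_left _ _ hV.a₆_mem))
  -- Subtracting the two equations gives `(w₂ - w₁) · U = (s₂ - s₁) · N` with `U` the unit above.
  -- The quotient `N / U` is the slope, and remains meaningful when the points coincide.
  obtain ⟨lam, hlam⟩ := hu.dvd (a := s₁ ^ 2 + s₁ * s₂ + s₂ ^ 2 +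
          V.a₂ * w₂ * (s₁ + s₂) + V.a₄ * w₂ ^ 2 - V.a₁ * w₂)
  have hlI : lam ∈ I ^ 2 := by
    rw [← Ideal.unit_mul_mem_iff_mem _ hu, ← hlam]
    have h11 : s₁ ^ 2 ∈ I ^ 2 := Ideal.pow_mem_pow hs₁ 2
    have h22 : s₂ ^ 2 ∈ I ^ 2 := Ideal.pow_mem_pow hs₂ 2
    have h12 : s₁ * s₂ ∈ I ^ 2 := by
      rw [pow_two]
      exact Ideal.mul_mem_mul hs₁ hs₂
    have e1 : V.a₂ * w₂ * (s₁ + s₂) ∈ I ^ 2 :=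
      Ideal.mul_mem_right _ _ (Ideal.mul_mem_left _ _ hw₂)
    have e2 : V.a₄ * w₂ ^ 2 ∈ I ^ 2 := Ideal.mul_mem_left _ _ (Ideal.pow_mem_of_mem _ hw₂ _ two_pos)
    exact sub_mem (add_mem (add_mem (add_mem (add_mem h11 h12) h22) e1) e2)
      (Ideal.mul_mem_left _ _ hw₂)
  refine ⟨lam, w₁ - lam * s₁, hlI, sub_mem hw₁ (Ideal.mul_mem_right _ _ hlI), by ring, ?_, hu,
    hlam.symm⟩
  refine hu.mul_left_cancel ?_
  unfold InftyEquation at h₁ h₂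
  linear_combination h₂ - h₁ + (s₂ - s₁) * hlam

end IsSplitNodal

end WeierstrassCurve

/-! ### Chords at infinity compared with the affine group law. -/

namespace WeierstrassCurve

open IsLocalRing

variable {R : Type*} [CommRing R] {K : Type*} [Field K] [Algebra R K]
  [IsFractionRing R K]

/-- `P` has the integral coordinates `s = x / y` and `w = 1 / y` around the point at infinity. -/
def HasInftyCoordinates (V : WeierstrassCurve R) :
    (V.baseChange K).toAffine.Point → R → R → Prop
  | .zero, s, w => s = 0 ∧ w = 0
  | .some x y _, s, w => x * algebraMap R K w = algebraMap R K s ∧ y * algebraMap R K w = 1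

theorem HasInftyCoordinates.inftyEquation {V : WeierstrassCurve R} (h3 : V.a₃ = 0)
    {P : (V.baseChange K).toAffine.Point} {s w : R} (h : HasInftyCoordinates V P s w) :
    V.InftyEquation s w := by
  rcases P with _ | ⟨x, y, hP⟩
  · obtain ⟨rfl, rfl⟩ := h
    simp [InftyEquation]
  · obtain ⟨hs, hw⟩ := h
    have heq := (Affine.equation_iff' _ _).mp hP.1
    simp only [baseChange, map_a₁, map_a₂, map_a₃, map_a₄, map_a₆, h3, map_zero] at heq
    apply IsFractionRing.injective R K
    simp only [map_add, map_mul, map_pow, ← hs]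
    generalize algebraMap R K w = w at *
    linear_combination w ^ 3 * heq - (w * (y * w + 1) + algebraMap R K V.a₁ * x * w ^ 2) * hw

/-- The coefficients of the cubic cut out by a chord or tangent. -/
theorem Affine.vieta_slope [DecidableEq K] {W : WeierstrassCurve K} {x₁ x₂ y₁ y₂ : K}
    (h₁ : W.toAffine.Equation x₁ y₁) (h₂ : W.toAffine.Equation x₂ y₂)
    (hxy : ¬(x₁ = x₂ ∧ y₁ = W.toAffine.negY x₂ y₂)) {ℓ x₃ c : K}
    (hℓ : W.toAffine.slope x₁ x₂ y₁ y₂ = ℓ) (hx₃ : W.toAffine.addX x₁ x₂ ℓ = x₃)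
    (hc : c = y₁ - ℓ * x₁) :
    x₁ + x₂ + x₃ = ℓ ^ 2 + W.a₁ * ℓ - W.a₂ ∧
    x₁ * x₂ + x₁ * x₃ + x₂ * x₃ = W.a₄ - 2 * ℓ * c - W.a₁ * c - W.a₃ * ℓ ∧
    x₁ * x₂ * x₃ = c ^ 2 + W.a₃ * c - W.a₆ := by
  have key := Affine.addPolynomial_slope h₁ h₂ hxy
  rw [hℓ, hx₃, Affine.addPolynomial_eq, neg_inj, Cubic.prod_X_sub_C_eq,
    Cubic.toPoly_injective] at key
  obtain ⟨-, -, k2, k3⟩ := Cubic.ext_iff.mp key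
  simp only at k2 k3
  refine ⟨?_, ?_, ?_⟩
  · rw [← hx₃, Affine.addX]
    ring
  · rw [hc]
    linear_combination -k2
  · rw [hc]
    linear_combination k3

namespace IsSplitNodal

variable [IsLocalRing R] {V : WeierstrassCurve R} (hV : V.IsSplitNodal)
include hV

open Classical in
theorem exists_chord_slope {x₁ y₁ x₂ y₂ : K} {P₁ : (V.baseChange K).toAffine.Nonsingular x₁ y₁}
    {P₂ : (V.baseChange K).toAffine.Nonsingular x₂ y₂}
    (hxy : ¬(x₁ = x₂ ∧ y₁ = (V.baseChange K).toAffine.negY x₂ y₂)) {s₁ w₁ s₂ w₂ : R}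
    (h₁ : HasInftyCoordinates V (.some x₁ y₁ P₁) s₁ w₁)
    (h₂ : HasInftyCoordinates V (.some x₂ y₂ P₂) s₂ w₂)
    {I : Ideal R} (hs₁ : s₁ ∈ I) (hs₂ : s₂ ∈ I) :
    ∃ lam ν : R, lam ∈ I ^ 2 ∧ ν ∈ I ^ 2 ∧ w₁ = lam * s₁ + ν ∧ w₂ = lam * s₂ + ν ∧
      algebraMap R K lam * x₁ + algebraMap R K ν * y₁ = 1 ∧
      algebraMap R K lam * x₂ + algebraMap R K ν * y₂ = 1 ∧
      (V.baseChange K).toAffine.slope x₁ x₂ y₁ y₂ * algebraMap R K ν = -algebraMap R K lam := by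
  obtain ⟨lam, ν, hlam, hν, hw₁, hw₂, hu, hul⟩ := hV.exists_chord (h₁.inftyEquation hV.a₃_eq)
    (h₂.inftyEquation hV.a₃_eq) hs₁ hs₂
  have on_line : ∀ {x y : K} {s w : R}, x * algebraMap R K w = algebraMap R K s →
      y * algebraMap R K w = 1 → w = lam * s + ν →
      algebraMap R K lam * x + algebraMap R K ν * y = 1 := by
    intro x y s w hs hw hl
    have hl := congrArg (algebraMap R K) hl
    simp only [map_add, map_mul] at hl
    linear_combination hw - y * hl + algebraMap R K lam * y * hs - algebraMap R K lam * x * hw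
  have l₁ := on_line h₁.1 h₁.2 hw₁
  have l₂ := on_line h₂.1 h₂.2 hw₂
  refine ⟨lam, ν, hlam, hν, hw₁, hw₂, l₁, l₂, ?_⟩
  by_cases hx : x₁ = x₂
  · have hy : y₁ ≠ (V.baseChange K).toAffine.negY x₂ y₂ := fun h => hxy ⟨hx, h⟩
    obtain rfl := hx
    obtain rfl := Affine.Y_eq_of_Y_ne P₁.1 P₂.1 rfl hy
    obtain ⟨h1s, h1w⟩ := h₁
    obtain ⟨h2s, h2w⟩ := h₂
    have hy0 : y₁ ≠ 0 := by
      rintro rfl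
      simp at h1w
    have hww : algebraMap R K w₂ = algebraMap R K w₁ := mul_left_cancel₀ hy0 (h2w.trans h1w.symm)
    have hss : algebraMap R K s₂ = algebraMap R K s₁ := by rw [← h1s, ← h2s, hww]
    have heq := (Affine.equation_iff' _ _).mp P₁.1
    have hm : y₁ - (V.baseChange K).toAffine.negY x₁ y₁ =
        2 * y₁ + algebraMap R K V.a₁ * x₁ := by
      simp only [Affine.negY, baseChange, map_a₁, map_a₃, hV.a₃_eq, map_zero]
      ring
    have hd : 2 * y₁ + algebraMap R K V.a₁ * x₁ ≠ 0 := by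
      rw [← hm]
      exact sub_ne_zero.mpr hy
    have hul := congrArg (algebraMap R K) hul
    have hu := (hu.map (algebraMap R K)).ne_zero
    have hw₁ := congrArg (algebraMap R K) hw₁
    rw [Affine.slope_of_Y_ne rfl hy, hm, div_mul_eq_mul_div, div_eq_iff hd]
    simp only [baseChange, map_a₁, map_a₂, map_a₃, map_a₄, map_a₆, hV.a₃_eq, map_zero] at heq ⊢
    simp only [map_add, map_sub, map_mul, map_pow, map_one, hww, hss] at hu hul hw₁
    rw [← h1s] at hu hul hw₁
    clear h1s h2s hss hww h2w
    generalize algebraMap R K w₁ = w at *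
    generalize algebraMap R K V.a₁ = a₁ at *
    generalize algebraMap R K V.a₂ = a₂ at *
    generalize algebraMap R K V.a₄ = a₄ at *
    generalize algebraMap R K V.a₆ = a₆ at *
    generalize algebraMap R K lam = lam at *
    generalize algebraMap R K ν = ν at *
    -- Tangent case: in affine coordinates both sides of `U · lam = N` acquire a factor `w²`, and `N
    -- / w²` is the numerator of the affine tangent slope.
    have hU : 1 + a₁ * (x₁ * w) - a₂ * (x₁ * w) ^ 2 - a₄ * (x₁ * w) * (w + w) -
        a₆ * (w ^ 2 + w * w + w ^ 2) =
        w ^ 2 * (y₁ ^ 2 + a₁ * x₁ * y₁ - a₂ * x₁ ^ 2 - 2 * a₄ * x₁ - 3 * a₆) := by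
      linear_combination -(y₁ * w + 1 + a₁ * x₁ * w) * h1w
    have hN : (x₁ * w) ^ 2 + x₁ * w * (x₁ * w) + (x₁ * w) ^ 2 + a₂ * w * (x₁ * w + x₁ * w) +
        a₄ * w ^ 2 - a₁ * w = w ^ 2 * (3 * x₁ ^ 2 + 2 * a₂ * x₁ + a₄ - a₁ * y₁) := by
      linear_combination a₁ * w * h1w
    rw [hU] at hu hul
    rw [hN] at hul
    refine mul_left_cancel₀ hu ?_
    linear_combination (2 * y₁ + a₁ * x₁ - x₁ * w * (3 * x₁ ^ 2 + 2 * a₂ * x₁ + a₄ - a₁ * y₁)) * hul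
      - (w ^ 2 * (y₁ ^ 2 + a₁ * x₁ * y₁ - a₂ * x₁ ^ 2 - 2 * a₄ * x₁ - 3 * a₆)) *
        (3 * x₁ ^ 2 + 2 * a₂ * x₁ + a₄ - a₁ * y₁) * hw₁
      + (3 * x₁ ^ 2 + 2 * a₂ * x₁ + a₄ - a₁ * y₁) * (3 * w ^ 3 * heq -
        w ^ 2 * (2 * y₁ + a₁ * x₁) * h1w)
  · rw [Affine.slope_of_X_ne hx, div_mul_eq_mul_div, div_eq_iff (sub_ne_zero.mpr hx)]
    linear_combination l₁ - l₂

end IsSplitNodal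

end WeierstrassCurve

/-! ### Approximate multiplicativity of `1 + a₁s`. -/

namespace WeierstrassCurve

open IsLocalRing

namespace IsSplitNodal

variable {R : Type*} [CommRing R] {K : Type*} [Field K] [Algebra R K] [IsFractionRing R K]
  [IsLocalRing R] {V : WeierstrassCurve R} (hV : V.IsSplitNodal)
include hV

open Classical in
/-- The points with integral coordinates around infinity are closed under addition, and
`1 + a₁ x / y` is multiplicative on them, to an accuracy that improves near the origin. -/
theorem exists_add {P₁ P₂ : (V.baseChange K).toAffine.Point} {s₁ w₁ s₂ w₂ : R}
    (h₁ : HasInftyCoordinates V P₁ s₁ w₁) (h₂ : HasInftyCoordinates V P₂ s₂ w₂)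
    {I : Ideal R} (hs₁ : s₁ ∈ I) (hs₂ : s₂ ∈ I) :
    ∃ s w : R, HasInftyCoordinates V (P₁ + P₂) s w ∧ s ∈ I ∧
      (1 + V.a₁ * s) - (1 + V.a₁ * s₁) * (1 + V.a₁ * s₂) ∈ maximalIdeal R * I ^ 2 := by
  suffices h : ∃ s w : R, HasInftyCoordinates V (P₁ + P₂) s w ∧
      (1 + V.a₁ * s) - (1 + V.a₁ * s₁) * (1 + V.a₁ * s₂) ∈ maximalIdeal R * I ^ 2 by
    obtain ⟨s, w, h, hm⟩ := h
    refine ⟨s, w, h, ?_, hm⟩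
    have hm' : maximalIdeal R * I ^ 2 ≤ I := Ideal.mul_le_right.trans (Ideal.pow_le_self two_ne_zero)
    rw [← Ideal.unit_mul_mem_iff_mem _ hV.isUnit_a₁]
    have : V.a₁ * s = ((1 + V.a₁ * s) - (1 + V.a₁ * s₁) * (1 + V.a₁ * s₂)) +
      (V.a₁ * s₁ + (1 + V.a₁ * s₁) * V.a₁ * s₂) := by ring
    rw [this]
    exact add_mem (hm' hm) (add_mem (Ideal.mul_mem_left _ _ hs₁) (Ideal.mul_mem_left _ _ hs₂))
  rcases P₁ with _ | ⟨x₁, y₁, P₁⟩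
  · obtain ⟨rfl, rfl⟩ := h₁
    refine ⟨s₂, w₂, ?_, by simp⟩
    convert! h₂
  rcases P₂ with _ | ⟨x₂, y₂, P₂⟩
  · obtain ⟨rfl, rfl⟩ := h₂
    refine ⟨s₁, w₁, ?_, by simp⟩
    convert! h₁
  have hinj := IsFractionRing.injective R K
  by_cases hxy : x₁ = x₂ ∧ y₁ = (V.baseChange K).toAffine.negY x₂ y₂
  · refine ⟨0, 0, ?_, ?_⟩
    · rw [Affine.Point.add_of_Y_eq hxy.1 hxy.2]
      exact ⟨rfl, rfl⟩
    -- For opposite points the two values are exactly inverse.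
    · have : (1 + V.a₁ * s₁) * (1 + V.a₁ * s₂) = 1 := by
        obtain ⟨rfl, hy⟩ := hxy
        obtain ⟨h1s, h1w⟩ := h₁
        obtain ⟨h2s, h2w⟩ := h₂
        simp only [Affine.negY, baseChange, map_a₁, map_a₃, hV.a₃_eq, map_zero, sub_zero] at hy
        apply hinj
        simp only [map_add, map_mul, map_one, ← h1s, ← h2s]
        generalize algebraMap R K w₁ = w₁ at *
        generalize algebraMap R K w₂ = w₂ at *
        generalize algebraMap R K V.a₁ = a₁ at *
        have hy₁ : y₁ ≠ 0 := left_ne_zero_of_mul_eq_one h1w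
        have hy₂ : y₂ ≠ 0 := left_ne_zero_of_mul_eq_one h2w
        rw [eq_inv_of_mul_eq_one_right h1w, eq_inv_of_mul_eq_one_right h2w]
        field_simp
        linear_combination a₁ * x₁ * hy
      simp [this]
  · obtain ⟨lam, ν, hlam, hν, hw₁, hw₂, l₁, l₂, hsl⟩ := hV.exists_chord_slope hxy h₁ h₂ hs₁ hs₂
    rw [Affine.Point.add_some hxy]
    obtain ⟨ℓ, hℓ⟩ : ∃ ℓ, (V.baseChange K).toAffine.slope x₁ x₂ y₁ y₂ = ℓ := ⟨_, rfl⟩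
    obtain ⟨x₃, hx₃⟩ : ∃ x₃, (V.baseChange K).toAffine.addX x₁ x₂ ℓ = x₃ := ⟨_, rfl⟩
    obtain ⟨c, hc⟩ : ∃ c, c = y₁ - ℓ * x₁ := ⟨_, rfl⟩
    obtain ⟨y₃, hy₃⟩ : ∃ y₃, y₃ = ℓ * (x₃ - x₁) + y₁ := ⟨_, rfl⟩
    obtain ⟨v1, v2, v3⟩ := Affine.vieta_slope P₁.1 P₂.1 hxy hℓ hx₃ hc
    rw [hℓ] at hsl
    simp only [baseChange, map_a₁, map_a₂, map_a₃, map_a₄, map_a₆, hV.a₃_eq, map_zero, zero_mul,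
      add_zero, sub_zero] at v1 v2 v3
    have hcν : c * algebraMap R K ν = 1 := by
      rw [hc]
      linear_combination l₁ - x₁ * hsl
    have l₃ : algebraMap R K lam * x₃ + algebraMap R K ν * y₃ = 1 := by
      rw [hy₃]
      linear_combination l₁ + (x₃ - x₁) * hsl
    -- the leading coefficient of the cubic, its sum of roots, and its value at `-1 / a₁`
    obtain ⟨d, hd⟩ : ∃ d, d = 1 + (V.a₂ * lam + V.a₄ * lam ^ 2 + V.a₆ * lam ^ 3) := ⟨_, rfl⟩
    have hdu : IsUnit d := by
      rw [hd]
      exact isUnit_add_mem isUnit_one (add_mem (add_mem (Ideal.mul_mem_right _ _ hV.a₂_mem)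
        (Ideal.mul_mem_right _ _ hV.a₄_mem)) (Ideal.mul_mem_right _ _ hV.a₆_mem))
    obtain ⟨b, hb⟩ := hdu.dvd (a := V.a₁ * lam - V.a₂ * ν - 2 * V.a₄ * lam * ν -
      3 * V.a₆ * lam ^ 2 * ν)
    have hd0 := (hdu.map (algebraMap R K)).ne_zero
    have hℓc : ℓ = -algebraMap R K lam * c := by linear_combination c * hsl - ℓ * hcν
    have hbK := congrArg (algebraMap R K) hb
    have hdK := congrArg (algebraMap R K) hd
    simp only [map_add, map_sub, map_mul, map_pow, map_one, map_ofNat] at hbK hdK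
    obtain ⟨h1s, h1w⟩ := h₁
    obtain ⟨h2s, h2w⟩ := h₂
    have hy₁0 : y₁ ≠ 0 := left_ne_zero_of_mul_eq_one h1w
    have hy₂0 : y₂ ≠ 0 := left_ne_zero_of_mul_eq_one h2w
    have hs₁y : algebraMap R K s₁ = x₁ / y₁ := by
      rw [← h1s, eq_inv_of_mul_eq_one_right h1w, div_eq_mul_inv]
    have hs₂y : algebraMap R K s₂ = x₂ / y₂ := by
      rw [← h2s, eq_inv_of_mul_eq_one_right h2w, div_eq_mul_inv]
    have e₁ : algebraMap R K ν * y₁ = 1 - algebraMap R K lam * x₁ := by linear_combination l₁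
    have e₂ : algebraMap R K ν * y₂ = 1 - algebraMap R K lam * x₂ := by linear_combination l₂
    have e₃ : algebraMap R K ν * y₃ = 1 - algebraMap R K lam * x₃ := by linear_combination l₃
    rw [hℓc] at v1 v2
    have hlead : algebraMap R K d = (algebraMap R K ν * y₁) * (algebraMap R K ν * y₂) *
        (algebraMap R K ν * y₃) := by
      rw [e₁, e₂, e₃]
      linear_combination hdK + algebraMap R K lam * v1 - algebraMap R K lam ^ 2 * v2 +
        algebraMap R K lam ^ 3 * v3
    have hν0 : algebraMap R K ν ≠ 0 := right_ne_zero_of_mul_eq_one hcν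
    have hy₃0 : y₃ ≠ 0 := by
      rintro rfl
      exact hd0 (by rw [hlead]; ring)
    have hsum : algebraMap R K d * (x₁ / y₁ + x₂ / y₂ + x₃ / y₃) =
        algebraMap R K d * algebraMap R K b := by
      rw [← hbK]
      have : algebraMap R K d * (x₁ / y₁ + x₂ / y₂ + x₃ / y₃) = algebraMap R K ν *
          (x₁ * (algebraMap R K ν * y₂) * (algebraMap R K ν * y₃) +
          x₂ * (algebraMap R K ν * y₁) * (algebraMap R K ν * y₃) +
          x₃ * (algebraMap R K ν * y₁) * (algebraMap R K ν * y₂)) := by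
        rw [hlead]
        field_simp
      rw [this, e₁, e₂, e₃]
      linear_combination algebraMap R K ν * v1 - 2 * algebraMap R K ν * algebraMap R K lam * v2 +
        3 * algebraMap R K ν * algebraMap R K lam ^ 2 * v3 +
        algebraMap R K V.a₁ * algebraMap R K lam * hcν
    -- The third intersection point is integral because the sum of the roots is: the leading
    -- coefficient `d` is a unit.
    obtain ⟨s₃, hs₃⟩ : ∃ s₃, s₃ = b - s₁ - s₂ := ⟨_, rfl⟩
    have hs₃y : algebraMap R K s₃ = x₃ / y₃ := by
      rw [hs₃, map_sub, map_sub, ← mul_left_cancel₀ hd0 hsum, hs₁y, hs₂y]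
      ring
    have hprod : d * ((1 + V.a₁ * s₁) * (1 + V.a₁ * s₂) * (1 + V.a₁ * s₃)) =
        1 - V.a₂ * (V.a₁ * ν - lam) + V.a₄ * (V.a₁ * ν - lam) ^ 2 -
          V.a₆ * (V.a₁ * ν - lam) ^ 3 := by
      apply hinj
      simp only [map_add, map_sub, map_mul, map_pow, map_one, hs₁y, hs₂y, hs₃y]
      have : algebraMap R K d * ((1 + algebraMap R K V.a₁ * (x₁ / y₁)) *
          (1 + algebraMap R K V.a₁ * (x₂ / y₂)) * (1 + algebraMap R K V.a₁ * (x₃ / y₃))) =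
          (algebraMap R K ν * y₁ + algebraMap R K V.a₁ * algebraMap R K ν * x₁) *
          (algebraMap R K ν * y₂ + algebraMap R K V.a₁ * algebraMap R K ν * x₂) *
          (algebraMap R K ν * y₃ + algebraMap R K V.a₁ * algebraMap R K ν * x₃) := by
        rw [hlead]
        field_simp
      rw [this, e₁, e₂, e₃]
      generalize algebraMap R K V.a₁ = a₁ at *
      generalize algebraMap R K ν = n at *
      generalize algebraMap R K lam = l at *
      linear_combination (a₁ * n - l) * v1 + (a₁ * n - l) ^ 2 * v2 + (a₁ * n - l) ^ 3 * v3 +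
        a₁ ^ 2 * c * n * (a₁ * n - l) * hcν
    have hl₃ : algebraMap R K (lam * s₃ + ν) = y₃⁻¹ := by
      rw [map_add, map_mul, hs₃y]
      field_simp
      linear_combination l₃
    have ht₃ : IsUnit (1 + V.a₁ * s₃) := by
      have hu : IsUnit (d * ((1 + V.a₁ * s₁) * (1 + V.a₁ * s₂) * (1 + V.a₁ * s₃))) := by
        rw [hprod]
        have : 1 - V.a₂ * (V.a₁ * ν - lam) + V.a₄ * (V.a₁ * ν - lam) ^ 2 -
          V.a₆ * (V.a₁ * ν - lam) ^ 3 = 1 + (V.a₂ * -(V.a₁ * ν - lam) +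
            V.a₄ * (V.a₁ * ν - lam) ^ 2 + V.a₆ * -(V.a₁ * ν - lam) ^ 3) := by ring
        rw [this]
        exact isUnit_add_mem isUnit_one (add_mem (add_mem (Ideal.mul_mem_right _ _ hV.a₂_mem)
          (Ideal.mul_mem_right _ _ hV.a₄_mem)) (Ideal.mul_mem_right _ _ hV.a₆_mem))
      exact isUnit_of_mul_isUnit_right (isUnit_of_mul_isUnit_right hu)
    obtain ⟨t, ht⟩ := isUnit_iff_exists_inv.mp ht₃
    -- The sum is the negative of the third point; negation divides `-s` and `-w` by `1 + a₁s`, and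
    -- so inverts `1 + a₁s`.
    refine ⟨-s₃ * t, -(lam * s₃ + ν) * t, ?_, ?_⟩
    · have htK := congrArg (algebraMap R K) ht
      simp only [map_add, map_mul, map_one, hs₃y] at htK
      have hy₃' : (V.baseChange K).toAffine.negAddY x₁ x₂ y₁ ℓ = y₃ := by
        rw [Affine.negAddY, hx₃, hy₃]
      constructor
      · rw [hℓ, hx₃, map_mul, map_neg, hl₃, map_mul, map_neg, hs₃y]
        ring
      · rw [hℓ, Affine.addY, hx₃, hy₃', map_mul, map_neg, hl₃]
        simp only [Affine.negY, baseChange, map_a₁, map_a₃, hV.a₃_eq, map_zero, sub_zero]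
        rw [← htK]
        field_simp
        ring
    -- After multiplication by units the error is `d` minus the product in `hprod`. Each term has a
    -- factor `a₂`, `a₄` or `a₆` in `𝔪` and a factor in `I²` coming from `lam` and `ν`.
    · rw [← Ideal.unit_mul_mem_iff_mem _ ht₃, ← Ideal.unit_mul_mem_iff_mem _ hdu]
      have : d * ((1 + V.a₁ * s₃) * (1 + V.a₁ * (-s₃ * t) - (1 + V.a₁ * s₁) * (1 + V.a₁ * s₂))) =
          V.a₂ * (V.a₁ * ν) + V.a₄ * (lam ^ 2 - (V.a₁ * ν - lam) ^ 2) +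
          V.a₆ * (lam ^ 3 + (V.a₁ * ν - lam) ^ 3) := by
        linear_combination -hprod + hd - d * V.a₁ * s₃ * ht
      rw [this]
      have hZ : V.a₁ * ν - lam ∈ I ^ 2 := sub_mem (Ideal.mul_mem_left _ _ hν) hlam
      exact add_mem (add_mem (Ideal.mul_mem_mul hV.a₂_mem (Ideal.mul_mem_left _ _ hν))
        (Ideal.mul_mem_mul hV.a₄_mem (sub_mem (Ideal.pow_mem_of_mem _ hlam _ two_pos)
          (Ideal.pow_mem_of_mem _ hZ _ two_pos))))
        (Ideal.mul_mem_mul hV.a₆_mem (add_mem (Ideal.pow_mem_of_mem _ hlam _ three_pos)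
          (Ideal.pow_mem_of_mem _ hZ _ three_pos)))

end IsSplitNodal

end WeierstrassCurve

/-! ### Absence of `p`-torsion in the chart at infinity. -/

namespace WeierstrassCurve

open IsLocalRing

theorem exists_one_add_pow_odd {R : Type*} [CommRing R] (x : R) (k : ℕ) :
    ∃ r, (1 + x) ^ (2 * k + 1) = 1 + (2 * k + 1) * x + k * (2 * k + 1) * x ^ 2 + x ^ 3 * r := by
  induction k with
  | zero => exact ⟨0, by simp⟩
  | succ k ih =>
    obtain ⟨r, hr⟩ := ih
    refine ⟨r * (1 + x) ^ 2 + (2 * k + 1) + 2 * k * (2 * k + 1) + k * (2 * k + 1) * x, ?_⟩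
    push_cast
    linear_combination (1 + x) ^ 2 * hr

/-- For `p = 2k + 1` the quadratic binomial coefficient is `kp`; dividing by `x` leaves `p(1 + kx) =
mx - x²r`, which lies in `𝔪²`. -/
theorem eq_zero_of_one_add_pow_sub_one {R : Type*} [CommRing R] [IsDomain R] [IsLocalRing R]
    {p : ℕ} (hodd : Odd p) (hp : (p : R) ∉ maximalIdeal R ^ 2) {x m : R}
    (hx : x ∈ maximalIdeal R) (hm : m ∈ maximalIdeal R) (h : (1 + x) ^ p - 1 = m * x ^ 2) :
    x = 0 := by
  by_contra hx0
  apply hp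
  obtain ⟨k, rfl⟩ := hodd
  obtain ⟨r, hr⟩ := exists_one_add_pow_odd x k
  have hu : IsUnit (1 + k * x) := isUnit_add_mem isUnit_one (Ideal.mul_mem_left _ _ hx)
  rw [← Ideal.mul_unit_mem_iff_mem _ hu]
  have : ((2 * k + 1 : ℕ) : R) * (1 + k * x) = m * x - x * x * r := by
    apply mul_left_cancel₀ hx0
    push_cast
    linear_combination h - hr
  rw [this, pow_two]
  exact sub_mem (Ideal.mul_mem_mul hm hx) (Ideal.mul_mem_right _ _ (Ideal.mul_mem_mul hx hx))

namespace IsSplitNodal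

variable {R : Type*} [CommRing R] {K : Type*} [Field K] [Algebra R K] [IsFractionRing R K]
  [IsLocalRing R] {V : WeierstrassCurve R} (hV : V.IsSplitNodal)

open Classical in
/-- The points with integral coordinates around infinity. -/
def inftySubgroup (hV : V.IsSplitNodal) : AddSubgroup (V.baseChange K).toAffine.Point where
  carrier := {P | ∃ s w : R, HasInftyCoordinates V P s w}
  zero_mem' := ⟨0, 0, rfl, rfl⟩
  add_mem' := by
    rintro P Q ⟨s₁, w₁, h₁⟩ ⟨s₂, w₂, h₂⟩
    obtain ⟨s, w, h, -⟩ := hV.exists_add h₁ h₂ (I := ⊤) trivial trivial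
    exact ⟨s, w, h⟩
  neg_mem' := by
    rintro (_ | ⟨x, y, hP⟩) ⟨s, w, h⟩
    · exact ⟨0, 0, rfl, rfl⟩
    · obtain ⟨t, ht⟩ := isUnit_iff_exists_inv.mp
        (hV.isUnit_of_inftyEquation (h.inftyEquation hV.a₃_eq))
      obtain ⟨hs, hw⟩ := h
      refine ⟨-s * t, -w * t, ?_⟩
      have htK := congrArg (algebraMap R K) ht
      simp only [map_add, map_mul, map_one] at htK
      constructor
      · simp only [map_mul, map_neg, ← hs]
        ring
      · simp only [Affine.negY, baseChange, map_a₁, map_a₃, hV.a₃_eq, map_zero, sub_zero,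
          map_mul, map_neg]
        linear_combination htK + algebraMap R K t * hw +
          algebraMap R K V.a₁ * algebraMap R K t * hs

include hV

open Classical in
theorem exists_nsmul {P : (V.baseChange K).toAffine.Point} {s w : R}
    (h : HasInftyCoordinates V P s w) {I : Ideal R} (hs : s ∈ I) (n : ℕ) :
    ∃ s' w' : R, HasInftyCoordinates V (n • P) s' w' ∧ s' ∈ I ∧
      (1 + V.a₁ * s') - (1 + V.a₁ * s) ^ n ∈ maximalIdeal R * I ^ 2 := by
  induction n with
  | zero => exact ⟨0, 0, by rw [zero_nsmul]; exact ⟨rfl, rfl⟩, I.zero_mem, by simp⟩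
  | succ n ih =>
    obtain ⟨s₁, w₁, h₁, hs₁, ht₁⟩ := ih
    obtain ⟨s₂, w₂, h₂, hs₂, ht₂⟩ := hV.exists_add h₁ h hs₁ hs
    refine ⟨s₂, w₂, by rwa [succ_nsmul], hs₂, ?_⟩
    have : (1 + V.a₁ * s₂) - (1 + V.a₁ * s) ^ (n + 1) =
        ((1 + V.a₁ * s₂) - (1 + V.a₁ * s₁) * (1 + V.a₁ * s)) +
        ((1 + V.a₁ * s₁) - (1 + V.a₁ * s) ^ n) * (1 + V.a₁ * s) := by ring
    rw [this]
    exact add_mem ht₂ (Ideal.mul_mem_right _ _ ht₁)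

open Classical in
theorem eq_zero_of_nsmul_eq_zero [IsDomain R] {p : ℕ} (hodd : Odd p)
    (hp : (p : R) ∉ maximalIdeal R ^ 2) (hk : ∀ x : ResidueField R, x ^ p = 1 → x = 1)
    {P : (V.baseChange K).toAffine.Point} (hP : P ∈ hV.inftySubgroup) (h : p • P = 0) :
    P = 0 := by
  obtain ⟨s, w, hsw⟩ := hP
  have key : ∀ I : Ideal R, s ∈ I → (1 + V.a₁ * s) ^ p - 1 ∈ maximalIdeal R * I ^ 2 := by
    intro I hs
    obtain ⟨s', w', h', -, ht⟩ := hV.exists_nsmul hsw hs p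
    rw [h] at h'
    obtain ⟨rfl, rfl⟩ := h'
    rw [← neg_mem_iff]
    simpa using ht
  have hs : s ∈ maximalIdeal R := by
    -- `I = ⊤` gives multiplicativity modulo `𝔪`, that is, in the residue field.
    have h1 := Ideal.mul_le_left (key ⊤ trivial)
    rw [← residue_eq_zero_iff, map_sub, map_pow, map_one, sub_eq_zero] at h1
    have h2 := hk _ h1
    rw [← map_one (residue R), ← sub_eq_zero, ← map_sub, residue_eq_zero_iff,
      add_sub_cancel_left] at h2
    exact (Ideal.unit_mul_mem_iff_mem _ hV.isUnit_a₁).mp h2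
  -- The smallest ideal containing `s` gives the sharpest estimate, an error in `𝔪 · (a₁s)²`.
  have h2 := key (Ideal.span {V.a₁ * s})
    ((Ideal.unit_mul_mem_iff_mem _ hV.isUnit_a₁).mp (Ideal.mem_span_singleton_self _))
  rw [Ideal.span_singleton_pow, Ideal.mem_mul_span_singleton] at h2
  obtain ⟨m, hm, hme⟩ := h2
  have hs0 := eq_zero_of_one_add_pow_sub_one hodd hp (Ideal.mul_mem_left _ _ hs) hm hme.symm
  rw [hV.isUnit_a₁.mul_right_eq_zero] at hs0
  have hw := hV.mem_pow_three_of_inftyEquation (hsw.inftyEquation hV.a₃_eq) (I := ⊥) hs0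
  have hw0 : w = 0 := by simpa using Ideal.pow_le_self three_ne_zero hw
  rcases P with _ | ⟨x, y, hP⟩
  · rfl
  · exact absurd hsw.2 (by simp [hw0])

end IsSplitNodal

end WeierstrassCurve

/-! ### Normal form of a split node, in every residue characteristic. -/

namespace WeierstrassCurve

open IsLocalRing

open Classical in
theorem Affine.Point.exists_hom_of_variableChange_eq {K : Type*} [Field K]
    {W W' : WeierstrassCurve K} (C : VariableChange K) (h : C • W = W') :
    ∃ φ : W.toAffine.Point →+ W'.toAffine.Point, Function.Injective φ ∧
      ∀ (x y : K) (hP : W.toAffine.Nonsingular x y), ∃ hQ,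
        φ (.some x y hP) = .some ((C.u⁻¹ : Kˣ) ^ 2 * (x - C.r))
          ((C.u⁻¹ : Kˣ) ^ 3 * (y - C.s * (x - C.r) - C.t)) hQ := by
  subst h
  exact ⟨variableChange W C, variableChange_injective W C, fun x y hP => ⟨_, rfl⟩⟩

/-- Moving the node of the reduction to the origin, and one of its tangents to `y = 0`. -/
theorem exists_isSplitNodal {R : Type*} [CommRing R] [IsLocalRing R] (W : WeierstrassCurve R)
    (hc : IsUnit W.c₄) (hΔ : W.Δ ∈ maximalIdeal R) {T : R}
    (hT : W.c₄ * T ^ 2 + W.a₁ * W.c₄ * T - (54 * W.b₆ - 3 * W.b₂ * W.b₄ + W.a₂ * W.c₄) ∈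
      maximalIdeal R) :
    ∃ C : VariableChange R, C.u = 1 ∧ (C • W).IsSplitNodal := by
  -- `(r, t)` lifts the node. These formulas satisfy `2t + a₁r + a₃ = 0` exactly, so the new `a₃` is
  -- zero and not merely in `𝔪`.
  obtain ⟨r, hr⟩ := hc.dvd (a := 18 * W.b₆ - W.b₂ * W.b₄)
  obtain ⟨t, ht⟩ := hc.dvd (a := W.b₂ * (W.a₁ * W.a₄ - 2 * W.a₂ * W.a₃) + 12 * W.a₃ * W.b₄ -
    9 * W.a₁ * W.b₆)
  have h3 : W.a₃ + r * W.a₁ + 2 * t = 0 := by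
    refine hc.mul_left_cancel ?_
    have : W.c₄ * (W.a₃ + r * W.a₁ + 2 * t) = W.c₄ * W.a₃ + (W.c₄ * r) * W.a₁ +
      2 * (W.c₄ * t) := by ring
    rw [this, ← hr, ← ht]
    simp only [c₄, b₂, b₄, b₆]
    ring
  -- Divided by `c₄`, the quadratic in `hT` becomes `T² + a₁T - (a₂ + 3r)`, whose roots modulo `𝔪`
  -- are the tangent slopes at the node.
  have h2 : W.a₂ - T * W.a₁ + 3 * r - T ^ 2 ∈ maximalIdeal R := by
    rw [← Ideal.unit_mul_mem_iff_mem _ hc, ← neg_mem_iff]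
    convert! hT using 1
    linear_combination 3 * hr
  have h4 : W.a₄ - T * W.a₃ + 2 * r * W.a₂ - (t + r * T) * W.a₁ + 3 * r ^ 2 - 2 * T * t ∈
      maximalIdeal R := by
    rw [← Ideal.unit_mul_mem_iff_mem _ (hc.pow 2)]
    have : W.c₄ ^ 2 * (W.a₄ - T * W.a₃ + 2 * r * W.a₂ - (t + r * T) * W.a₁ + 3 * r ^ 2 -
        2 * T * t) = W.c₄ ^ 2 * W.a₄ + 2 * (W.c₄ * r) * W.a₂ * W.c₄ - (W.c₄ * t) * W.a₁ * W.c₄ +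
          3 * (W.c₄ * r) ^ 2 := by
      linear_combination -W.c₄ ^ 2 * T * h3
    have : W.c₄ ^ 2 * (W.a₄ - T * W.a₃ + 2 * r * W.a₂ - (t + r * T) * W.a₁ + 3 * r ^ 2 -
        2 * T * t) = -36 * W.Δ := by
      rw [this, ← hr, ← ht]
      simp only [Δ, c₄, b₂, b₄, b₆, b₈]
      ring
    rw [this]
    exact Ideal.mul_mem_left _ _ hΔ
  have h6 : W.a₆ + r * W.a₄ + r ^ 2 * W.a₂ + r ^ 3 - t * W.a₃ - t ^ 2 - r * t * W.a₁ ∈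
      maximalIdeal R := by
    rw [← Ideal.unit_mul_mem_iff_mem _ (hc.pow 3)]
    have : W.c₄ ^ 3 * (W.a₆ + r * W.a₄ + r ^ 2 * W.a₂ + r ^ 3 - t * W.a₃ - t ^ 2 -
        r * t * W.a₁) = W.c₄ ^ 3 * W.a₆ + W.c₄ ^ 2 * (W.c₄ * r) * W.a₄ +
          W.c₄ * (W.c₄ * r) ^ 2 * W.a₂ + (W.c₄ * r) ^ 3 - W.c₄ ^ 2 * (W.c₄ * t) * W.a₃ -
          W.c₄ * (W.c₄ * t) ^ 2 - W.c₄ * (W.c₄ * r) * (W.c₄ * t) * W.a₁ := by ring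
    have : W.c₄ ^ 3 * (W.a₆ + r * W.a₄ + r ^ 2 * W.a₂ + r ^ 3 - t * W.a₃ - t ^ 2 -
        r * t * W.a₁) = W.c₆ * W.Δ := by
      rw [this, ← hr, ← ht]
      simp only [Δ, c₆, c₄, b₂, b₄, b₆, b₈]
      ring
    rw [this]
    exact Ideal.mul_mem_left _ _ hΔ
  obtain ⟨C, hC⟩ : ∃ C : VariableChange R, C = ⟨1, r, T, t⟩ := ⟨_, rfl⟩
  have k2 : (C • W).a₂ ∈ maximalIdeal R := by
    rw [variableChange_a₂, hC]
    simpa using h2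
  have k3 : (C • W).a₃ = 0 := by
    rw [variableChange_a₃, hC]
    simpa using h3
  have k4 : (C • W).a₄ ∈ maximalIdeal R := by
    rw [variableChange_a₄, hC]
    simpa using h4
  have k6 : (C • W).a₆ ∈ maximalIdeal R := by
    rw [variableChange_a₆, hC]
    simpa using h6
  refine ⟨C, by rw [hC], ?_, k2, k3, k4, k6⟩
  have hc' : IsUnit (C • W).c₄ := by
    rw [variableChange_c₄, hC]
    simpa using hc
  by_contra h1
  refine (mem_maximalIdeal _).mp ?_ hc'
  have h1 : (C • W).a₁ ∈ maximalIdeal R := h1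
  have : (C • W).c₄ = (C • W).a₁ * (C • W).a₁ * ((C • W).a₁ ^ 2 + 8 * (C • W).a₂) +
      16 * (C • W).a₂ * (C • W).a₂ - 48 * (C • W).a₄ := by
    simp only [c₄, b₂, b₄, k3]
    ring
  rw [this]
  exact sub_mem (add_mem (Ideal.mul_mem_right _ _ (Ideal.mul_mem_right _ _ h1))
    (Ideal.mul_mem_left _ _ k2)) (Ideal.mul_mem_left _ _ k4)

end WeierstrassCurve

/-! ### Points with nonsingular reduction lie in the chart at infinity. -/

namespace WeierstrassCurve

open IsLocalRing

section

variable {R : Type*} [CommRing R] [IsDomain R] [IsDiscreteValuationRing R]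
  {K : Type*} [Field K] [Algebra R K] [IsFractionRing R K]

theorem exists_isSplitNodal_of_hasSplitMultiplicativeReduction (W : WeierstrassCurve K)
    [W.IsMinimal R] (h : W.HasSplitMultiplicativeReduction R) :
    ∃ C : VariableChange R, C.u = 1 ∧ (C • W.integralModel R).IsSplitNodal := by
  have hΔ : (W.integralModel R).Δ ∈ maximalIdeal R := by
    have := h.badReduction
    rw [← integralModel_Δ_eq R W] at this
    exact (IsDedekindDomain.HeightOneSpectrum.valuation_lt_one_iff_mem _ _).mp this
  have hc : IsUnit (W.integralModel R).c₄ := by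
    have := h.multiplicativeReduction
    rw [← integralModel_c₄_eq R W] at this
    exact not_not.mp (IsDedekindDomain.HeightOneSpectrum.valuation_eq_one_iff_notMem _ |>.mp this)
  have hc' : algebraMap R (ResidueField R) (W.integralModel R).c₄ ≠ 0 := (hc.map _).ne_zero
  obtain ⟨τ, hτ⟩ := h.splitMultiplicativeReduction.exists_eval_eq_zero (by
    simp only [Polynomial.map_add, Polynomial.map_mul, Polynomial.map_pow,
      Polynomial.map_C, Polynomial.map_X, sub_eq_add_neg, ← Polynomial.C_neg]
    rw [Polynomial.degree_quadratic hc']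
    decide)
  obtain ⟨T, rfl⟩ := residue_surjective τ
  refine exists_isSplitNodal _ hc hΔ (T := T) ?_
  rw [← residue_eq_zero_iff, ← hτ]
  simp [ResidueField.algebraMap_eq]

/-- Either `y` or `1 / y` is integral. In the first case `x` is a root of a monic integral cubic,
contrary to `h`; in the second `x / y` is such a root. -/
theorem mem_inftySubgroup_of_not_integral {V : WeierstrassCurve R} (hV : V.IsSplitNodal) {x y : K}
    (hP : (V.baseChange K).toAffine.Nonsingular x y)
    (h : ¬∃ x₀ y₀ : R, algebraMap R K x₀ = x ∧ algebraMap R K y₀ = y) :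
    Affine.Point.some x y hP ∈ hV.inftySubgroup := by
  have heq := (Affine.equation_iff' _ _).mp hP.1
  simp only [baseChange, map_a₁, map_a₂, map_a₃, map_a₄, map_a₆, hV.a₃_eq, map_zero] at heq
  have cubic : ∀ (b c d : R) (z : K), z ^ 3 + algebraMap R K b * z ^ 2 + algebraMap R K c * z +
      algebraMap R K d = 0 → ∃ z₀ : R, algebraMap R K z₀ = z := by
    intro b c d z hz
    refine IsIntegrallyClosed.isIntegral_iff.mp ⟨Cubic.toPoly ⟨1, b, c, d⟩, ?_, ?_⟩
    · exact Cubic.monic_of_a_eq_one'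
    · simpa [Cubic.toPoly] using hz
  rcases ValuationRing.isInteger_or_isInteger R y with ⟨y₀, hy⟩ | ⟨w, hw⟩
  · refine absurd ?_ h
    obtain ⟨x₀, hx⟩ := cubic V.a₂ (V.a₄ - V.a₁ * y₀) (V.a₆ - y₀ ^ 2) x (by
      simp only [map_sub, map_mul, map_pow, hy]
      linear_combination -heq)
    exact ⟨x₀, y₀, hx, hy⟩
  -- Since `0⁻¹ = 0`, integrality of `y⁻¹` does not exclude `y = 0`.
  · by_cases hy0 : y = 0
    · refine absurd ?_ h
      subst hy0
      obtain ⟨x₀, hx⟩ := cubic V.a₂ V.a₄ V.a₆ x (by linear_combination -heq)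
      exact ⟨x₀, 0, hx, map_zero _⟩
    · obtain ⟨s, hs⟩ := cubic (V.a₂ * w) (V.a₄ * w ^ 2 - V.a₁ * w) (V.a₆ * w ^ 3 - w) (x * y⁻¹) (by
        simp only [map_sub, map_mul, map_pow, hw]
        field_simp
        linear_combination -heq)
      exact ⟨s, w, by rw [hw, hs], by rw [hw, mul_inv_cancel₀ hy0]⟩

theorem mem_inftySubgroup_of_isUnit {V : WeierstrassCurve R} (hV : V.IsSplitNodal) {x y : R}
    (hP : (V.baseChange K).toAffine.Nonsingular (algebraMap R K x) (algebraMap R K y))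
    (h : IsUnit y) : Affine.Point.some _ _ hP ∈ hV.inftySubgroup := by
  obtain ⟨w, hw⟩ := isUnit_iff_exists_inv.mp h
  exact ⟨x * w, w, by rw [map_mul], by rw [← map_mul, hw, map_one]⟩

/-- If `y` reduces to `0`, the equation forces `x` to reduce to `0` as well, and the origin is the
node. -/
theorem IsSplitNodal.isUnit_of_nonsingular {V : WeierstrassCurve R} (hV : V.IsSplitNodal)
    {x y : R} (hP : V.toAffine.Equation x y)
    (hr : (V.map (residue R)).toAffine.Nonsingular (residue R x) (residue R y)) : IsUnit y := by
  by_contra hy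
  have hy : y ∈ maximalIdeal R := hy
  have heq := (Affine.equation_iff' _ _).mp hP
  have hx : x ∈ maximalIdeal R := by
    refine Ideal.IsPrime.mem_of_pow_mem inferInstance 3 ?_
    have : x ^ 3 = y * (y + V.a₁ * x + V.a₃) -
        (V.a₂ * x ^ 2 + V.a₄ * x + V.a₆) := by linear_combination -heq
    rw [this]
    exact sub_mem (Ideal.mul_mem_right _ _ hy) (add_mem (add_mem
      (Ideal.mul_mem_right _ _ hV.a₂_mem) (Ideal.mul_mem_right _ _ hV.a₄_mem)) hV.a₆_mem)
  rw [(residue_eq_zero_iff x).mpr hx, (residue_eq_zero_iff y).mpr hy,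
    Affine.nonsingular_zero] at hr
  simp [hV.a₃_eq, (residue_eq_zero_iff _).mpr hV.a₄_mem] at hr

end

end WeierstrassCurve

/-! ### From the Tamagawa number to local torsion. -/

namespace TamagawaCondition

open WeierstrassCurve IsLocalRing

variable {R : Type*} [CommRing R] [IsDomain R] [IsDiscreteValuationRing R]
  {K : Type*} [Field K] [Algebra R K] [IsFractionRing R K]

open Classical in
theorem exists_hom_inftySubgroup (W : WeierstrassCurve K) [W.IsMinimal R]
    (h : W.HasSplitMultiplicativeReduction R) :
    ∃ (V : WeierstrassCurve R) (hV : V.IsSplitNodal)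
      (φ : W.toAffine.Point →+ (V.baseChange K).toAffine.Point), Function.Injective φ ∧
      ∀ P ∈ nonsingularReductionSubgroup R W, φ P ∈ hV.inftySubgroup := by
  obtain ⟨C, hu, hV⟩ := exists_isSplitNodal_of_hasSplitMultiplicativeReduction W h
  refine ⟨_, hV, ?_⟩
  obtain ⟨φ, hφ, hφs⟩ := Affine.Point.exists_hom_of_variableChange_eq (W := W)
    (W' := (C • W.integralModel R).baseChange K) (C.map (algebraMap R K)) (by
      conv_lhs => rw [← baseChange_integralModel_eq R W]
      exact map_variableChange _ _ _)
  refine ⟨φ, hφ, fun P hP => ?_⟩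
  suffices hle : nonsingularReductionSubgroup R W ≤ hV.inftySubgroup.comap φ from hle hP
  refine (AddSubgroup.closure_le _).mpr ?_
  rintro (_ | ⟨x, y, hxy⟩) hns
  · change φ 0 ∈ hV.inftySubgroup
    rw [map_zero]
    exact zero_mem _
  · obtain ⟨hQ, hφP⟩ := hφs x y hxy
    change φ _ ∈ hV.inftySubgroup
    rw [hφP]
    by_cases hint : ∃ x₀ y₀ : R, algebraMap R K x₀ = x ∧ algebraMap R K y₀ = y
    · obtain ⟨x₀, y₀, rfl, rfl⟩ := hint
      have hns := hns x₀ y₀ rfl rfl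
      have ex : ((C.map (algebraMap R K)).u⁻¹ : Kˣ) ^ 2 *
          (algebraMap R K x₀ - (C.map (algebraMap R K)).r) = algebraMap R K (x₀ - C.r) := by
        simp [VariableChange.map, hu]
      have ey : ((C.map (algebraMap R K)).u⁻¹ : Kˣ) ^ 3 *
          (algebraMap R K y₀ - (C.map (algebraMap R K)).s *
            (algebraMap R K x₀ - (C.map (algebraMap R K)).r) - (C.map (algebraMap R K)).t) =
          algebraMap R K (y₀ - C.s * (x₀ - C.r) - C.t) := by
        simp [VariableChange.map, hu]
      have hQ' := hQ
      rw [ex, ey] at hQ'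
      have := mem_inftySubgroup_of_isUnit hV hQ' (hV.isUnit_of_nonsingular (x := x₀ - C.r) ?_ ?_)
      · convert! this
      · exact (Affine.map_equation _ (IsFractionRing.injective R K) _ _).mp hQ'.1
      · have := (Affine.variableChange_nonsingular _ (C.map (residue R)) _ _).mpr hns
        rw [reduction, map_variableChange] at this
        convert! this using 1 <;> simp [VariableChange.map, hu]
    -- A change of variables over `R` with `u = 1` preserves integrality of coordinates in both
    -- directions.
    · refine mem_inftySubgroup_of_not_integral hV hQ fun ⟨x₁, y₁, hx, hy⟩ => hint ?_
      simp only [VariableChange.map, hu, map_one, inv_one, Units.val_one, one_pow, one_mul] at hx hy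
      refine ⟨x₁ + C.r, y₁ + C.s * x₁ + C.t, ?_, ?_⟩
      · rw [map_add, hx]
        ring
      · rw [map_add, map_add, map_mul, hx, hy]
        ring

/-- Bézout for `p` and the index. An infinite index is recorded as `0`, which `p` divides, so it is
excluded. -/
theorem mem_of_nsmul_eq_zero {G : Type*} [AddCommGroup G] (H : AddSubgroup G) {p : ℕ}
    (hp : p.Prime) (h : ¬p ∣ H.index) {g : G} (hg : p • g = 0) : g ∈ H := by
  have h1 := H.nsmul_index_mem g
  have hc : IsCoprime (p : ℤ) (H.index : ℤ) :=
    Nat.isCoprime_iff_coprime.mpr ((hp.coprime_iff_not_dvd).mpr h)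
  obtain ⟨a, b, hab⟩ := hc
  have : g = a • (p • g) + b • (H.index • g) := by
    rw [← natCast_zsmul, ← natCast_zsmul, smul_smul, smul_smul, ← add_smul, hab, one_smul]
  rw [this, hg, smul_zero, zero_add]
  exact H.zsmul_mem h1 b

open Classical in
/-- Over a discretely valued field whose ramification index over `p` is at most `1`, a curve with
split multiplicative reduction has no `p`-torsion if `p` does not divide the Tamagawa number and
the residue field has no `p`-th roots of unity. -/
theorem eq_zero_of_nsmul_eq_zero (W : WeierstrassCurve K)
    (h : (W.minimal R).HasSplitMultiplicativeReduction R) {p : ℕ} (hp : p.Prime) (hodd : p ≠ 2)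
    (hpm : (p : R) ∉ maximalIdeal R ^ 2) (hk : ∀ x : ResidueField R, x ^ p = 1 → x = 1)
    (hc : ¬p ∣ tamagawaNumber R W) {P : W.toAffine.Point} (hP : p • P = 0) : P = 0 := by
  obtain ⟨V, hV, φ, hφ, hφP⟩ := exists_hom_inftySubgroup (W.minimal R) h
  obtain ⟨ψ, hψ, -⟩ := Affine.Point.exists_hom_of_variableChange_eq (W := W) (W' := W.minimal R)
    _ rfl
  have hψP : p • ψ P = 0 := by rw [← map_nsmul, hP, map_zero]
  have hmem := hφP _ (mem_of_nsmul_eq_zero _ hp hc hψP)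
  have h0 := hV.eq_zero_of_nsmul_eq_zero (hp.odd_of_ne_two hodd) hpm hk hmem
    (by rw [← map_nsmul, hψP, map_zero])
  exact (map_eq_zero_iff ψ hψ).mp ((map_eq_zero_iff φ hφ).mp h0)

end TamagawaCondition

/-! ### Galois descent and the arithmetic of `ℤ_ℓ`. -/

namespace TamagawaCondition

open WeierstrassCurve

section

variable {K L : Type*} [Field K] [Field L] [Algebra K L]

theorem exists_algebraMap_eq_of_restrictGalois [PerfectField L]
    (ι : AlgebraicClosure K →ₐ[K] AlgebraicClosure L) {x : AlgebraicClosure K}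
    (h : ∀ σ, restrictGalois ι σ x = x) : ∃ x₀ : L, algebraMap L (AlgebraicClosure L) x₀ = ι x := by
  refine (InfiniteGalois.mem_range_algebraMap_iff_fixed _).mpr fun σ => ?_
  rw [← restrictGalois_spec, h]

open Classical in
-- A fixed point has coordinates in `L`, so `ι` sends it to the image of an `L`-point; injectivity
-- into the points over the closure of `L` makes that `L`-point `p`-torsion.
theorem localH0_torsionRepresentation_eq_bot [PerfectField L]
    (ι : AlgebraicClosure K →ₐ[K] AlgebraicClosure L) (E : WeierstrassCurve K) (p : ℕ)
    (h : ∀ P : (E.baseChange L).toAffine.Point, p • P = 0 → P = 0) :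
    localH0 ι (torsionRepresentation E p) = ⊥ := by
  rw [eq_bot_iff]
  rintro ⟨P, hP⟩ hfix
  have hpP : p • P = 0 := AddSubgroup.torsionBy.nsmul_iff.mp hP
  have hfix : ∀ σ, galoisActionOnPoints E (restrictGalois ι σ) P = P := fun σ =>
    congrArg Subtype.val (hfix σ)
  refine (Submodule.mem_bot _).mpr (Subtype.ext ?_)
  change P = 0
  rcases P with _ | ⟨x, y, hxy⟩
  · rfl
  have hxy' := fun σ => (Affine.Point.some.injEq ..).mp (hfix σ)
  obtain ⟨x₀, hx⟩ := exists_algebraMap_eq_of_restrictGalois ι fun σ => (hxy' σ).1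
  obtain ⟨y₀, hy⟩ := exists_algebraMap_eq_of_restrictGalois ι fun σ => (hxy' σ).2
  have hn := (E.toAffine.baseChange_nonsingular ι.injective x y).mpr hxy
  rw [← hx, ← hy] at hn
  have hn₀ := (E.toAffine.baseChange_nonsingular
    (f := (IsScalarTower.toAlgHom K L (AlgebraicClosure L)))
    (algebraMap L (AlgebraicClosure L)).injective x₀ y₀).mp hn
  have hmap : Affine.Point.map (W' := E.toAffine) (IsScalarTower.toAlgHom K L (AlgebraicClosure L))
      (.some x₀ y₀ hn₀) = Affine.Point.map (W' := E.toAffine) ι (.some x y hxy) := by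
    rw [Affine.Point.map_some, Affine.Point.map_some]
    exact (Affine.Point.some.injEq ..).mpr ⟨hx, hy⟩
  have h0 := h (.some x₀ y₀ hn₀) (Affine.Point.map_injective (W' := E.toAffine)
    (IsScalarTower.toAlgHom K L (AlgebraicClosure L)) (by
      rw [map_nsmul, hmap, ← map_nsmul, hpP, _root_.map_zero, _root_.map_zero]))
  exact absurd h0 (Affine.Point.some_ne_zero _)

end

/-- Membership would mean `ℓ² ∣ p`. This covers `ℓ = p` too, because `ℚ_p` is unramified over
itself. -/
theorem natCast_notMem_maximalIdeal_sq (ℓ : ℕ) [Fact ℓ.Prime] {p : ℕ} (hp : p.Prime) :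
    (p : ℤ_[ℓ]) ∉ IsLocalRing.maximalIdeal ℤ_[ℓ] ^ 2 := by
  rw [PadicInt.maximalIdeal_eq_span_p, Ideal.span_singleton_pow, ← PadicInt.ker_toZModPow,
    RingHom.mem_ker, map_natCast, ZMod.natCast_eq_zero_iff]
  intro h
  have h1 := (Nat.prime_dvd_prime_iff_eq Fact.out hp).mp ((dvd_pow_self ℓ two_ne_zero).trans h)
  subst h1
  have := Nat.le_of_dvd hp.pos h
  nlinarith [hp.two_le]

theorem eq_one_of_pow_eq_one_residueField (ℓ : ℕ) [Fact ℓ.Prime] {p : ℕ} (hp : p.Prime)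
    (h : ¬p ∣ ℓ - 1) (x : IsLocalRing.ResidueField ℤ_[ℓ]) (hx : x ^ p = 1) : x = 1 := by
  apply PadicInt.residueField.injective
  rw [map_one]
  have hx := congrArg PadicInt.residueField hx
  rw [map_pow, map_one] at hx
  generalize PadicInt.residueField x = z at hx
  have hz : z ≠ 0 := by
    rintro rfl
    simp [hp.ne_zero] at hx
  have hc : Nat.gcd p (ℓ - 1) = 1 := hp.coprime_iff_not_dvd.mpr h
  simpa [hc] using pow_gcd_eq_one.mpr ⟨hx, ZMod.pow_card_sub_one_eq_one hz⟩

theorem localInvariantsVanish_of_isSplitMultiplicativePrime (E : WeierstrassCurve ℚ) {p : ℕ}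
    (hp : p.Prime) (hodd : p ≠ 2) (ℓ : ℕ) [Fact ℓ.Prime] (hs : IsSplitMultiplicativePrime E ℓ)
    (hc : ¬p ∣ tamagawaNumberAt E ℓ) (hℓ : ¬p ∣ ℓ - 1) : LocalInvariantsVanish E ℓ p := fun ι =>
  localH0_torsionRepresentation_eq_bot ι E p fun _ hP =>
    eq_zero_of_nsmul_eq_zero _ hs hp hodd (natCast_notMem_maximalIdeal_sq ℓ hp)
      (eq_one_of_pow_eq_one_residueField ℓ hp hℓ) hc hP

end TamagawaCondition

end

theorem mainTheorem12 (E : WeierstrassCurve ℚ) [E.IsElliptic] (p : ℕ) (hp : p.Prime)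
    (hodd : p ≠ 2) :
    (∀ (ℓ : ℕ) [Fact ℓ.Prime], TamagawaCondition.IsSplitMultiplicativePrime E ℓ →
      ¬ p ∣ TamagawaCondition.tamagawaNumberAt E ℓ → ¬ p ∣ ℓ - 1 → TamagawaCondition.LocalInvariantsVanish E ℓ p) ∧
    ((∀ (ℓ : ℕ) [Fact ℓ.Prime], TamagawaCondition.IsBadPrime E ℓ →
      TamagawaCondition.IsSplitMultiplicativePrime E ℓ ∧ ¬ p ∣ TamagawaCondition.tamagawaNumberAt E ℓ ∧ ¬ p ∣ ℓ - 1) → TamagawaCondition.HTam E p) := by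
  have key := fun (ℓ : ℕ) [Fact ℓ.Prime] =>
    TamagawaCondition.localInvariantsVanish_of_isSplitMultiplicativePrime E hp hodd ℓ
  refine ⟨key, fun h ℓ _ hbad => ?_⟩
  obtain ⟨hs, hc, hℓ⟩ := h ℓ hbad
  exact key ℓ hs hc hℓ
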